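/- Let $n,m$ be nonnegative integers, $|\cdot|$ the Euclidean norm, $R_1>0$, $M>0$, $y_0\in\mathbb R^n$, $Q_1:=\{z\in\mathbb R^n:|z|\le R_1\}$, and let $U\subset\mathbb R^m$, $V\subset\mathbb R^n$ be compact. Let $f:\mathbb R^n\times\mathbb R^m\to\mathbb R^n$ be such that $f(x,\cdot)$ is Borel measurable for every $x$, $f(\cdot,u)$ is Lipschitz with a constant $K_f$ independent of $u\in U$, and $|f(x,u)|\le M_1$ on $\mathbb R^n\times U$ for some $M_1>0$. Put $h_L(x,y):=\frac12(|x-y|^2-R_1^2)$, and let $\gamma_k\to\infty$ with $\gamma_k>M/R_1$ for all $k$. On an interval $[0,T]$ let $\mathcal V$, $\mathcal U$, $\mathcal U_0$ be the sets of functions in $L_2$, $L_\infty$, $L_\infty$ with values a.e. in $V$, $U$, $[0,1]$, respectively. Let $N_C(z)$ be the limiting normal cone to $C$ at $z$, $B$ the closed unit ball, and $N^M_C(z):=N_C(z)\cap MB$. $\mathcal F_L(T,y)$ is the set of triples $(x,u,u_0)$, $x$ absolutely continuous on $[0,T]$, $u\in\mathcal U$, $u_0\in\mathcal U_0$, with $x(0)\in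 Q_1+y_0$, $x(t)\in Q_1+y(t)$ for all $t\in[0,T]$, $u_0(t)=0$ for a.e. $t$ with $x(t)\notin\partial(Q_1+y(t))$, and $\dot x=f(x,u)+\bar f(x,y)\,u_0\,(x-y)$ a.e., where $\bar f(x,y)=-M/R_1$ if $x\in\partial(Q_1+y)$ and $\bar f(x,y)=0$ otherwise. $\mathcal F^k_L(T,y)$ is the set of such triples of functions with $x(0)\in Q_1+y_0$, $h_L(x,y)\le0$ on $[0,T]$ and $$(D^k)\qquad \dot x=f(x,u)-u_0\,c(\gamma_k,x,y)\,(x-y)\ \text{ a.e.},\qquad c(\gamma,x,y):=\min\Big\{\frac M{R_1},\ \gamma e^{\gamma h_L(x,y)}\Big\}.$$ Let $T>0$, let $y$ be absolutely continuous on $[0,T]$ with $y(0)=y_0$ and $\dot y=v\in\mathcal V$ a.e., and let $(x,u,u_0)\in\mathcal F_L(T,y)$. Then there is a sequence $(T_k,y_k,x_k,v_k,u_k,u_{0,k})$, with $T_k>0$, $y_k,x_k$ absolutely continuous on $[0,T_k]$ and $v_k\in\mathcal V$, $u_k\in\mathcal U$, $u_{0,k}\in\mathcal U_0$ on $[0,T_k]$,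 such that 1) $|T-T_k|+|x_k(0)-x(0)|+\|(v_k,u_k,u_{0,k})-(v,u,u_0)\|_{L_1}\to0$ as $k\to\infty$, the controls being extended by $0$ beyond their intervals; 2) $y_k(0)=y_0$ and $\dot y_k=v_k$ a.e. on $[0,T_k]$; 3) $(x_k,u_k,u_{0,k})\in\mathcal F^k_L(T_k,y_k)$; and such that a subsequence of $\{x_k\}$ converges uniformly to $x$ (arcs being extended by their final values beyond their intervals). If, moreover, $f(z,\cdot)$ is continuous on $U$ for every $z$, then for every sequence as above satisfying 1)-3), a subsequence of $\{x_k\}$ converges uniformly to $x$. Finally, $x$ is a solution of $$(D)\qquad \dot x\in f(x,u)-N^M_{Q_1+y}(x)\ \text{ a.e. on }[0,T],\quad x(0)\in Q_1+y_0,\quad u\in\mathcal U,\quad h_L(x,y)\le0\ \text{ on }[0,T],$$ and every solution of $(D)$, with the same $(T,y)$ and $u$, that has the same initial value as $x$ coincides with $x$ on $[0,T]$. -/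

import Mathlib

open MeasureTheory Filter Topology Set
open scoped ENNReal NNReal

noncomputable section

namespace Sweeping

/-- `ℝⁿ` with the Euclidean norm. -/
abbrev E (n : ℕ) := EuclideanSpace ℝ (Fin n)

/-- `ζ` is a proximal normal to `C` at the point `z` of `C`. -/
def IsProximalNormal {n : ℕ} (C : Set (E n)) (z ζ : E n) : Prop :=
  z ∈ C ∧ ∃ σ : ℝ, 0 ≤ σ ∧ ∀ z' ∈ C, inner ℝ ζ (z' - z) ≤ σ * ‖z' - z‖ ^ 2

/-- The limiting (Mordukhovich) normal cone to `C` at `z`: limits of proximal normals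
to `C` at points of `C` that tend to `z`. -/
def normalCone {n : ℕ} (C : Set (E n)) (z : E n) : Set (E n) :=
  {ζ | ∃ zs ζs : ℕ → E n, Tendsto zs atTop (𝓝 z) ∧ Tendsto ζs atTop (𝓝 ζ) ∧
    ∀ i, IsProximalNormal C (zs i) (ζs i)}

/-- The truncated normal cone `N_C(z) ∩ M B`, `B` the closed unit ball. -/
def truncatedNormalCone {n : ℕ} (M : ℝ) (C : Set (E n)) (z : E n) : Set (E n) :=
  normalCone C z ∩ Metric.closedBall 0 M

/-- The state constraint function `h_L(x, y) = (|x - y|² - R₁²) / 2`. -/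
def hL {n : ℕ} (R₁ : ℝ) (x y : E n) : ℝ := (‖x - y‖ ^ 2 - R₁ ^ 2) / 2

/-- The data of the lower level system: the radius `R₁` of the ball `Q₁`, the truncation
level `M`, the drift `f`, the control sets `U` and `V`, the initial centre `y₀`. -/
structure Data (n m : ℕ) where
  R₁ : ℝ
  M : ℝ
  f : E n → E m → E n
  U : Set (E m)
  V : Set (E n)
  y₀ : E n

/-- The objects `(T, y, x, v, u, u₀)`; the functions matter on `[0, T]` only. -/
structure CtrlProcess (n m : ℕ) where
  T : ℝ
  y : ℝ → E n
  x : ℝ → E n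
  v : ℝ → E n
  u : ℝ → E m
  u₀ : ℝ → ℝ

/-- Lebesgue measure on `[0, T]`. -/
def timeMeasure (T : ℝ) : Measure ℝ := volume.restrict (Icc 0 T)

namespace Data

variable {n m : ℕ} (D : Data n m)

/-- Standing assumptions on the data. -/
structure Standing : Prop where
  R₁_pos : 0 < D.R₁
  M_pos : 0 < D.M
  measurable_f : ∀ x, Measurable (D.f x)
  lipschitz_f : ∃ K : ℝ≥0, ∀ u ∈ D.U, LipschitzWith K fun x => D.f x u
  bounded_f : ∃ M₁ : ℝ, 0 < M₁ ∧ ∀ x, ∀ u ∈ D.U, ‖D.f x u‖ ≤ M₁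
  compact_U : IsCompact D.U
  compact_V : IsCompact D.V

/-- The moving set `Q₁ + y`, where `Q₁` is the closed ball of radius `R₁` centred at `0`. -/
def movingSet (y : E n) : Set (E n) := Metric.closedBall y D.R₁

/-- The admissible controls `v` on `[0, T]`: square integrable with values in `V`. -/
def controlsV (T : ℝ) : Set (ℝ → E n) :=
  {v | MemLp v 2 (timeMeasure T) ∧ ∀ᵐ t ∂(timeMeasure T), v t ∈ D.V}

/-- The admissible controls `u` on `[0, T]`: essentially bounded with values in `U`. -/
def controlsU (T : ℝ) : Set (ℝ → E m) :=
  {u | MemLp u ∞ (timeMeasure T) ∧ ∀ᵐ t ∂(timeMeasure T), u t ∈ D.U}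

/-- The scalar controls `u₀` on `[0, T]`: measurable with values in `[0, 1]`. -/
def controlsU₀ (T : ℝ) : Set (ℝ → ℝ) :=
  {u₀ | MemLp u₀ ∞ (timeMeasure T) ∧ ∀ᵐ t ∂(timeMeasure T), u₀ t ∈ Icc (0 : ℝ) 1}

/-- Membership in the space of processes on `[0, T]`. -/
structure InSpace (p : CtrlProcess n m) : Prop where
  T_pos : 0 < p.T
  ac_y : AbsolutelyContinuousOnInterval p.y 0 p.T
  ac_x : AbsolutelyContinuousOnInterval p.x 0 p.T
  mem_v : p.v ∈ D.controlsV p.T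
  mem_u : p.u ∈ D.controlsU p.T
  mem_u₀ : p.u₀ ∈ controlsU₀ p.T

/-- `y(0) = y₀` and `ẏ = v` a.e. on `[0, T]`. -/
def UpperDynamics (p : CtrlProcess n m) : Prop :=
  p.y 0 = D.y₀ ∧ ∀ᵐ t ∂(timeMeasure p.T), HasDerivAt p.y (p.v t) t

open Classical in
/-- `f̄(x, y)`: equal to `-M / R₁` if `x` is on the boundary of `Q₁ + y`, and `0` otherwise. -/
def fbar (x y : E n) : ℝ := if x ∈ frontier (D.movingSet y) then -(D.M / D.R₁) else 0

/-- `(x, u, u₀)` is feasible for the lower level sweeping problem with parameter `(T, y)`: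
`ẋ = f(x, u) + f̄(x, y) u₀ (x - y)` a.e., where `u₀` takes nonzero values only while `x(t)` is
on the boundary of `Q₁ + y(t)`, `x(0) ∈ Q₁ + y₀`, and `x(t) ∈ Q₁ + y(t)` throughout. -/
structure FeasibleL (T : ℝ) (y x : ℝ → E n) (u : ℝ → E m) (u₀ : ℝ → ℝ) : Prop where
  ac_x : AbsolutelyContinuousOnInterval x 0 T
  mem_u : u ∈ D.controlsU T
  mem_u₀ : u₀ ∈ controlsU₀ T
  initial : x 0 ∈ D.movingSet D.y₀
  constraint : ∀ t ∈ Icc 0 T, x t ∈ D.movingSet (y t)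
  dynamics : ∀ᵐ t ∂(timeMeasure T),
    HasDerivAt x (D.f (x t) (u t) + (D.fbar (x t) (y t) * u₀ t) • (x t - y t)) t
  active : ∀ᵐ t ∂(timeMeasure T), u₀ t ≠ 0 → x t ∈ frontier (D.movingSet (y t))

/-- `c(γ, x, y) = min {M / R₁, γ exp(γ h_L(x, y))}`. -/
def penalty (γ : ℝ) (x y : E n) : ℝ :=
  min (D.M / D.R₁) (γ * Real.exp (γ * hL D.R₁ x y))

/-- `(x, u, u₀)` is feasible on `[0, T]` for the approximate system with penalty
parameter `γ`: `ẋ = f(x, u) - u₀ c(γ, x, y) (x - y)` a.e., `x(0) ∈ Q₁ + y₀`, `h_L(x, y) ≤ 0`. -/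
structure FeasibleApprox (γ : ℝ) (T : ℝ) (y x : ℝ → E n) (u : ℝ → E m) (u₀ : ℝ → ℝ) : Prop where
  ac_x : AbsolutelyContinuousOnInterval x 0 T
  mem_u : u ∈ D.controlsU T
  mem_u₀ : u₀ ∈ controlsU₀ T
  initial : x 0 ∈ D.movingSet D.y₀
  constraint : ∀ t ∈ Icc 0 T, hL D.R₁ (x t) (y t) ≤ 0
  dynamics : ∀ᵐ t ∂(timeMeasure T),
    HasDerivAt x (D.f (x t) (u t) - (u₀ t * D.penalty γ (x t) (y t)) • (x t - y t)) t

/-- `x` solves the sweeping inclusion with the truncated normal cone on `[0, T]`: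
`ẋ ∈ f(x, u) - N^M_{Q₁ + y}(x)` a.e., `x(0) ∈ Q₁ + y₀`, `u` admissible, `h_L(x, y) ≤ 0`. -/
structure SolvesInclusion (T : ℝ) (y : ℝ → E n) (u : ℝ → E m) (x : ℝ → E n) : Prop where
  ac_x : AbsolutelyContinuousOnInterval x 0 T
  mem_u : u ∈ D.controlsU T
  initial : x 0 ∈ D.movingSet D.y₀
  constraint : ∀ t ∈ Icc 0 T, hL D.R₁ (x t) (y t) ≤ 0
  inclusion : ∀ᵐ t ∂(timeMeasure T),
    ∃ ζ ∈ truncatedNormalCone D.M (D.movingSet (y t)) (x t),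
      HasDerivAt x (D.f (x t) (u t) - ζ) t

/-- `x` is the unique solution of the inclusion with its own initial value. -/
def IsUniqueSolution (T : ℝ) (y : ℝ → E n) (u : ℝ → E m) (x : ℝ → E n) : Prop :=
  D.SolvesInclusion T y u x ∧
    ∀ z : ℝ → E n, D.SolvesInclusion T y u z → z 0 = x 0 → EqOn z x (Icc 0 T)

end Data

/-- The `L¹` distance of two control triples defined on `[0, T]` and on `[0, T']`, each
extended by zero beyond its interval. -/
def controlDist {n m : ℕ} (p q : CtrlProcess n m) : ℝ≥0∞ :=
  eLpNorm ((Icc 0 p.T).indicator p.v - (Icc 0 q.T).indicator q.v) 1 volume +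
  eLpNorm ((Icc 0 p.T).indicator p.u - (Icc 0 q.T).indicator q.u) 1 volume +
  eLpNorm ((Icc 0 p.T).indicator p.u₀ - (Icc 0 q.T).indicator q.u₀) 1 volume

/-- The sequence `q` of processes approximates `p`: each `q k` belongs to the space of processes
on its own interval `[0, T_k]`, and
1) `|T - T_k| + |x_k(0) - x(0)| + Δ((v_k, u_k, u₀_k), (v, u, u₀)) → 0`;
2) `y_k(0) = y₀` and `ẏ_k = v_k` a.e. on `[0, T_k]`;
3) `(x_k, u_k, u₀_k)` is feasible for the approximate system with penalty parameter `γ k`. -/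
structure Approximates {n m : ℕ} (D : Data n m) (γ : ℕ → ℝ) (p : CtrlProcess n m)
    (q : ℕ → CtrlProcess n m) : Prop where
  mem : ∀ k, D.InSpace (q k)
  tendsto : Tendsto (fun k => ENNReal.ofReal (|p.T - (q k).T| + ‖(q k).x 0 - p.x 0‖) +
    controlDist (q k) p) atTop (𝓝 0)
  upper : ∀ k, D.UpperDynamics (q k)
  feasible : ∀ k, D.FeasibleApprox (γ k) (q k).T (q k).y (q k).x (q k).u (q k).u₀

/-- Uniform convergence of arcs `xs k` on `[0, Ts k]` to the arc `x` on `[0, T]`, each arc being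
extended beyond its interval by its final value. -/
def ArcsTendstoUniformly {n : ℕ} (Ts : ℕ → ℝ) (xs : ℕ → ℝ → E n) (T : ℝ) (x : ℝ → E n) : Prop :=
  TendstoUniformlyOn (fun k t => xs k (min t (Ts k))) (fun t => x (min t T)) atTop (Ici 0)

end Sweeping

end

/-! Existence needs no genuine approximation: the constant sequence `p` works. Where the multiplier
acts, `hL` vanishes, so the penalty is min(M/R₁, γ_k) = M/R₁ and the penalized term equals the
sweeping term; elsewhere u₀ = 0 (`FeasibleL.feasibleApprox`).

For an arbitrary approximating sequence, x_k is compared with x through |x_k - x|². Normal cones to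
a ball are monotone, and the penalty force is almost normal: its coefficient times the slack R₁² -
|x_k - y_k|² is O(γ_k^(-1/2)), uniformly in the position (`penalty_mul_le`, `inner_sub_penalty_le`).
With the Lipschitz drift, Grönwall's inequality (`norm_sq_sub_le`) leaves four errors: the initial
gap, the distance of the centres (at most the L¹ distance of the controls v), γ_k^(-1/2), and ∫
|f(x, u_k) - f(x, u)| with the arc x frozen. The last one vanishes along a subsequence on which u_k
→ u a.e., by dominated convergence; continuity of f in the control enters only there.

With exact monotonicity in place of the approximate one, the same computation gives uniqueness
(`SolvesInclusion.eqOn`). -/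

namespace Sweeping

/-! ### Absolutely continuous functions and Grönwall's inequality. -/

/-- Absolute continuity passes to functions with dominated increments. -/
theorem absolutelyContinuousOnInterval_of_dist_le {X Y : Type*} [PseudoMetricSpace X]
    [PseudoMetricSpace Y] {f : ℝ → X} {g : ℝ → Y} {a b C : ℝ}
    (hf : AbsolutelyContinuousOnInterval f a b)
    (h : ∀ s t, dist (g s) (g t) ≤ C * dist (f s) (f t)) :
    AbsolutelyContinuousOnInterval g a b := by
  have h0 := Tendsto.const_mul C hf
  rw [mul_zero] at h0
  refine squeeze_zero (fun t => Finset.sum_nonneg fun i _ => dist_nonneg) (fun t => ?_) h0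
  rw [Finset.mul_sum]
  exact Finset.sum_le_sum fun i _ => h _ _

theorem absolutelyContinuousOnInterval_norm_sq {F : Type*} [SeminormedAddCommGroup F] {f : ℝ → F}
    {a b : ℝ} (hf : AbsolutelyContinuousOnInterval f a b) :
    AbsolutelyContinuousOnInterval (fun t => ‖f t‖ ^ 2) a b := by
  have h : AbsolutelyContinuousOnInterval (fun t => ‖f t‖) a b :=
    absolutelyContinuousOnInterval_of_dist_le (C := 1) hf fun s t => by
      rw [one_mul, Real.dist_eq, dist_eq_norm]
      exact abs_norm_sub_norm_le _ _
  simpa only [sq] using h.fun_mul h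

theorem sub_le_integral_of_ae_deriv_le {φ g : ℝ → ℝ} {a b : ℝ} (hab : a ≤ b)
    (hφ : AbsolutelyContinuousOnInterval φ a b) (hg : IntegrableOn g (Icc a b))
    (h : ∀ᵐ t ∂(volume.restrict (Icc a b)), ∃ d, HasDerivAt φ d t ∧ d ≤ g t) :
    φ b - φ a ≤ ∫ t in a..b, g t := by
  rw [← hφ.integral_deriv_eq_sub]
  refine intervalIntegral.integral_mono_ae_restrict hab hφ.intervalIntegrable_deriv
    ((intervalIntegrable_iff_integrableOn_Icc_of_le hab).2 hg) ?_
  filter_upwards [h] with t ⟨d, hd, hdg⟩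
  rwa [hd.deriv]

/-- Pairing φ with the unit vector in the direction of φ(b) - φ(a) reduces the claim to the scalar
case. -/
theorem norm_sub_le_integral_of_ae_norm_deriv_le {F : Type*} [NormedAddCommGroup F]
    [InnerProductSpace ℝ F] {φ : ℝ → F} {g : ℝ → ℝ} {a b : ℝ} (hab : a ≤ b)
    (hφ : AbsolutelyContinuousOnInterval φ a b) (hg : IntegrableOn g (Icc a b))
    (h : ∀ᵐ t ∂(volume.restrict (Icc a b)), ∃ d, HasDerivAt φ d t ∧ ‖d‖ ≤ g t) :
    ‖φ b - φ a‖ ≤ ∫ t in a..b, g t := by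
  have h0 : 0 ≤ ∫ t in a..b, g t := by
    refine intervalIntegral.integral_nonneg_of_ae_restrict hab ?_
    filter_upwards [h] with t ⟨d, _, hd⟩
    exact (norm_nonneg _).trans hd
  rcases eq_or_ne (φ b - φ a) 0 with hz | hz
  · rwa [hz, norm_zero]
  set e : F := ‖φ b - φ a‖⁻¹ • (φ b - φ a) with he
  have hn : ‖e‖ = 1 := norm_smul_inv_norm (𝕜 := ℝ) hz
  have hac : AbsolutelyContinuousOnInterval (fun t => inner ℝ e (φ t)) a b :=
    absolutelyContinuousOnInterval_of_dist_le (C := 1) hφ fun s t => by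
      rw [Real.dist_eq, ← inner_sub_right, dist_eq_norm, ← hn]
      exact abs_real_inner_le_norm _ _
  have key := sub_le_integral_of_ae_deriv_le hab hac hg (by
    filter_upwards [h] with t ⟨d, hd, hdg⟩
    refine ⟨inner ℝ e d, ?_, ?_⟩
    · simpa using (hasDerivAt_const t e).inner ℝ hd
    · refine (real_inner_le_norm _ _).trans ?_
      rwa [hn, one_mul])
  rw [← inner_sub_right, he, real_inner_smul_left, real_inner_self_eq_norm_sq, sq,
    inv_mul_cancel_left₀ (norm_ne_zero_iff.2 hz)] at key
  exact key

/-- Grönwall's inequality for absolutely continuous functions. -/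
theorem le_exp_mul_of_ae_deriv_le {a g : ℝ → ℝ} {T C : ℝ} (hC : 0 ≤ C)
    (ha : AbsolutelyContinuousOnInterval a 0 T) (hg : IntegrableOn g (Icc 0 T))
    (hg0 : ∀ t, 0 ≤ g t)
    (h : ∀ᵐ t ∂(timeMeasure T), ∃ d, HasDerivAt a d t ∧ d ≤ C * a t + g t)
    {t : ℝ} (ht : t ∈ Icc 0 T) :
    a t ≤ Real.exp (C * t) * (a 0 + ∫ s in Icc 0 T, g s) := by
  have hsub : Icc 0 t ⊆ Icc 0 T := Icc_subset_Icc_right ht.2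
  have hexp : AbsolutelyContinuousOnInterval (fun s => Real.exp (-(C * s))) 0 t :=
    ContDiffOn.absolutelyContinuousOnInterval (by fun_prop)
  have ha' : AbsolutelyContinuousOnInterval a 0 t :=
    ha.mono (by rwa [uIcc_of_le ht.1, uIcc_of_le (ht.1.trans ht.2)])
  -- The function exp(-C s) a(s) is integrated. Since `g` is nonnegative, the factor exp(-C s) ≤ 1
  -- in front of it can be dropped and its integral enlarged to `[0, T]`.
  have key := sub_le_integral_of_ae_deriv_le ht.1 (hexp.fun_mul ha') (hg.mono_set hsub) (by
    filter_upwards [ae_restrict_of_ae_restrict_of_subset hsub h,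
      ae_restrict_mem measurableSet_Icc] with s ⟨d, hd, hdg⟩ hs
    have he : HasDerivAt (fun s => Real.exp (-(C * s))) (Real.exp (-(C * s)) * (-C)) s := by
      simpa using ((hasDerivAt_id s).const_mul C).neg.exp
    refine ⟨_, he.mul hd, ?_⟩
    have h1 : Real.exp (-(C * s)) ≤ 1 :=
      Real.exp_le_one_iff.2 (neg_nonpos.2 (mul_nonneg hC hs.1))
    calc Real.exp (-(C * s)) * (-C) * a s + Real.exp (-(C * s)) * d
        = Real.exp (-(C * s)) * (d - C * a s) := by ring
      _ ≤ Real.exp (-(C * s)) * g s :=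
          mul_le_mul_of_nonneg_left (by linarith) (Real.exp_pos _).le
      _ ≤ g s := mul_le_of_le_one_left (hg0 s) h1)
  have hint : ∫ s in (0 : ℝ)..t, g s ≤ ∫ s in Icc 0 T, g s := by
    rw [intervalIntegral.integral_of_le ht.1, ← integral_Icc_eq_integral_Ioc]
    exact setIntegral_mono_set hg (ae_of_all _ hg0) hsub.eventuallyLE
  simp only [mul_zero, neg_zero, Real.exp_zero, one_mul] at key
  have h2 : Real.exp (-(C * t)) * a t ≤ a 0 + ∫ s in Icc 0 T, g s := by linarith
  calc a t = Real.exp (C * t) * (Real.exp (-(C * t)) * a t) := by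
        rw [← mul_assoc, ← Real.exp_add, add_neg_cancel, Real.exp_zero, one_mul]
    _ ≤ _ := mul_le_mul_of_nonneg_left h2 (Real.exp_pos _).le

end Sweeping

/-! ### Normal cones to convex sets and to balls; the scalar penalty estimate. -/

namespace Sweeping

variable {n m : ℕ}

/-- The proximal inequality is tested at z + s(w - z), which convexity keeps in C; after division by
s the quadratic term is O(s) and vanishes as s → 0. -/
theorem IsProximalNormal.inner_le_zero {C : Set (E n)} (hC : Convex ℝ C) {z ζ w : E n}
    (h : IsProximalNormal C z ζ) (hw : w ∈ C) : inner ℝ ζ (w - z) ≤ 0 := by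
  obtain ⟨hz, σ, hσ, hζ⟩ := h
  have hlim : Tendsto (fun s : ℝ => σ * s * ‖w - z‖ ^ 2) (𝓝[>] 0) (𝓝 0) := by
    have : Tendsto (fun s : ℝ => σ * s * ‖w - z‖ ^ 2) (𝓝 0) (𝓝 (σ * 0 * ‖w - z‖ ^ 2)) :=
      Continuous.tendsto (by fun_prop) 0
    simpa using this.mono_left nhdsWithin_le_nhds
  refine ge_of_tendsto hlim ?_
  filter_upwards [Ioo_mem_nhdsGT one_pos] with s hs
  have h1 := hζ _ (hC.add_smul_sub_mem hz hw ⟨hs.1.le, hs.2.le⟩)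
  rw [add_sub_cancel_left, real_inner_smul_right, norm_smul, Real.norm_of_nonneg hs.1.le] at h1
  refine le_of_mul_le_mul_left ?_ hs.1
  linarith

theorem inner_le_zero_of_mem_normalCone {C : Set (E n)} (hC : Convex ℝ C) {z ζ w : E n}
    (h : ζ ∈ normalCone C z) (hw : w ∈ C) : inner ℝ ζ (w - z) ≤ 0 := by
  obtain ⟨zs, ζs, hz, hζ, hp⟩ := h
  exact le_of_tendsto (hζ.inner (tendsto_const_nhds.sub hz))
    (Eventually.of_forall fun i => (hp i).inner_le_zero hC hw)

theorem IsProximalNormal.mem_normalCone {C : Set (E n)} {z ζ : E n}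
    (h : IsProximalNormal C z ζ) : ζ ∈ normalCone C z :=
  ⟨fun _ => z, fun _ => ζ, tendsto_const_nhds, tendsto_const_nhds, fun _ => h⟩

theorem isProximalNormal_zero {C : Set (E n)} {z : E n} (hz : z ∈ C) :
    IsProximalNormal C z 0 :=
  ⟨hz, 0, le_rfl, fun z' _ => by simp⟩

/-- Cauchy–Schwarz gives the normal inequality with σ = 0. -/
theorem isProximalNormal_smul_sub {x y : E n} {R a : ℝ} (ha : 0 ≤ a) (hx : ‖x - y‖ = R) :
    IsProximalNormal (Metric.closedBall y R) x (a • (x - y)) := by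
  refine ⟨by rw [mem_closedBall_iff_norm, hx], 0, le_rfl, fun z hz => ?_⟩
  rw [mem_closedBall_iff_norm] at hz
  have h1 : inner ℝ (x - y) (z - x) = inner ℝ (x - y) (z - y) - ‖x - y‖ ^ 2 := by
    rw [← real_inner_self_eq_norm_sq, ← inner_sub_right, sub_sub_sub_cancel_right]
  have h2 := real_inner_le_norm (x - y) (z - y)
  have h3 : ‖x - y‖ * ‖z - y‖ ≤ ‖x - y‖ * R := mul_le_mul_of_nonneg_left hz (norm_nonneg _)
  rw [real_inner_smul_left, zero_mul]
  refine mul_nonpos_of_nonneg_of_nonpos ha ?_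
  rw [hx] at h1 h2 h3
  linarith [h1, h2, h3]

theorem hL_nonpos_iff {R : ℝ} (hR : 0 ≤ R) (x y : E n) : hL R x y ≤ 0 ↔ ‖x - y‖ ≤ R := by
  rw [← sq_le_sq₀ (norm_nonneg _) hR, hL]
  constructor <;> intro h <;> linarith

/-- In the square of the minimum, one factor is bounded by c and the other by the exponential. With
w = γ s / 2, what remains is 8c · (w²/2) exp(-w) ≤ 8c, so the bound does not depend on s. -/
theorem min_mul_exp_mul_le {c γ s : ℝ} (hc : 0 ≤ c) (hγ : 0 < γ) (hs : 0 ≤ s) :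
    min c (γ * Real.exp (-(γ * s / 2))) * s ≤ Real.sqrt (8 * c / γ) := by
  apply Real.le_sqrt_of_sq_le
  set k := min c (γ * Real.exp (-(γ * s / 2))) with hk
  have hk0 : 0 ≤ k := le_min hc (by positivity)
  have h1 : k ≤ c := min_le_left _ _
  have h2 : k ≤ γ * Real.exp (-(γ * s / 2)) := min_le_right _ _
  have hw : 0 ≤ γ * s / 2 := by positivity
  have h3 : (γ * s / 2) ^ 2 / 2 ≤ Real.exp (γ * s / 2) := by
    have := Real.quadratic_le_exp_of_nonneg hw
    linarith
  have h4 : (γ * s / 2) ^ 2 / 2 * Real.exp (-(γ * s / 2)) ≤ 1 := by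
    calc _ ≤ Real.exp (γ * s / 2) * Real.exp (-(γ * s / 2)) :=
          mul_le_mul_of_nonneg_right h3 (Real.exp_pos _).le
      _ = 1 := by rw [← Real.exp_add, add_neg_cancel, Real.exp_zero]
  rw [le_div_iff₀ hγ]
  calc (k * s) ^ 2 * γ = k * k * (s ^ 2 * γ) := by ring
    _ ≤ c * (γ * Real.exp (-(γ * s / 2))) * (s ^ 2 * γ) := by gcongr
    _ = 8 * c * ((γ * s / 2) ^ 2 / 2 * Real.exp (-(γ * s / 2))) := by ring
    _ ≤ 8 * c * 1 := mul_le_mul_of_nonneg_left h4 (by positivity)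
    _ = 8 * c := mul_one _

/-! ### The penalty force against the normal cone; feasibility and uniqueness. -/

namespace Data

variable {D : Data n m}

theorem Standing.frontier_movingSet (hD : D.Standing) (y : E n) :
    frontier (D.movingSet y) = {x | ‖x - y‖ = D.R₁} := by
  rw [movingSet, frontier_closedBall _ hD.R₁_pos.ne']
  ext x
  rw [mem_sphere_iff_norm, mem_ofPred_eq]

theorem Standing.div_pos (hD : D.Standing) : 0 < D.M / D.R₁ := _root_.div_pos hD.M_pos hD.R₁_pos

theorem Standing.penalty_nonneg (hD : D.Standing) {γ : ℝ} (hγ : 0 < γ) (x y : E n) :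
    0 ≤ D.penalty γ x y := le_min hD.div_pos.le (by positivity)

/-- Approximate complementary slackness: here s = R₁² - |x - y|² = -2 `hL`, so the penalty is small
wherever the slack is not. -/
theorem penalty_mul_le (hD : D.Standing) {γ : ℝ} (hγ : 0 < γ) {x y : E n}
    (h : ‖x - y‖ ≤ D.R₁) :
    D.penalty γ x y * (D.R₁ ^ 2 - ‖x - y‖ ^ 2) ≤ Real.sqrt (8 * (D.M / D.R₁) / γ) := by
  have hs : 0 ≤ D.R₁ ^ 2 - ‖x - y‖ ^ 2 := by
    have := pow_le_pow_left₀ (norm_nonneg _) h 2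
    linarith
  have := min_mul_exp_mul_le hD.div_pos.le hγ hs
  rwa [show -(γ * (D.R₁ ^ 2 - ‖x - y‖ ^ 2) / 2) = γ * hL D.R₁ x y by rw [hL]; ring] at this

theorem norm_penalty_smul_le (hD : D.Standing) {γ : ℝ} (hγ : 0 < γ) {x y : E n} {a : ℝ}
    (ha : a ∈ Icc (0 : ℝ) 1) (h : ‖x - y‖ ≤ D.R₁) :
    ‖(a * D.penalty γ x y) • (x - y)‖ ≤ D.M := by
  have h0 := hD.penalty_nonneg hγ x y
  rw [norm_smul, Real.norm_of_nonneg (mul_nonneg ha.1 h0)]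
  have h1 : D.penalty γ x y ≤ D.M / D.R₁ := min_le_left _ _
  calc a * D.penalty γ x y * ‖x - y‖ ≤ 1 * (D.M / D.R₁) * D.R₁ := by
        have := ha.1; have := ha.2; have := hD.div_pos; gcongr
    _ = D.M := by rw [one_mul, div_mul_cancel₀ _ hD.R₁_pos.ne']

/-- The elements of the truncated normal cones to one moving ball are monotone. -/
theorem inner_sub_nonneg_of_mem_truncatedNormalCone {y x z ζ ξ : E n}
    (hx : x ∈ D.movingSet y) (hz : z ∈ D.movingSet y)
    (hζ : ζ ∈ truncatedNormalCone D.M (D.movingSet y) x)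
    (hξ : ξ ∈ truncatedNormalCone D.M (D.movingSet y) z) :
    0 ≤ inner ℝ (ξ - ζ) (z - x) := by
  have h1 := inner_le_zero_of_mem_normalCone (convex_closedBall _ _) hζ.1 hz
  have h2 := inner_le_zero_of_mem_normalCone (convex_closedBall _ _) hξ.1 hx
  rw [← neg_sub, inner_neg_right] at h2
  rw [inner_sub_left]
  linarith

/-- The penalty term is monotone with respect to the normal cone up to a small error. -/
theorem inner_sub_penalty_le (hD : D.Standing) {γ : ℝ} (hγ : 0 < γ) {y x z w ζ : E n} {a : ℝ}
    (ha : a ∈ Icc (0 : ℝ) 1) (hx : ‖x - y‖ ≤ D.R₁) (hz : ‖z - w‖ ≤ D.R₁)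
    (hζ : ζ ∈ truncatedNormalCone D.M (D.movingSet y) x) :
    inner ℝ (ζ - (a * D.penalty γ z w) • (z - w)) (z - x) ≤
      2 * D.M * ‖w - y‖ + Real.sqrt (8 * (D.M / D.R₁) / γ) := by
  set k := a * D.penalty γ z w with hk
  have hp := hD.penalty_nonneg hγ z w
  have hk0 : 0 ≤ k := mul_nonneg ha.1 hp
  have hkM := norm_penalty_smul_le hD hγ ha hz
  have hR := hD.R₁_pos
  -- The point z lies in the ball about w, while ζ is normal to the ball about y; translating z by y
  -- - w makes it an admissible test point, at a cost of at most M |w - y|.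
  have h1 : inner ℝ ζ (z - x) ≤ D.M * ‖w - y‖ := by
    have hmem : z + (y - w) ∈ D.movingSet y := by
      rw [movingSet, mem_closedBall_iff_norm]
      rwa [show z + (y - w) - y = z - w by abel]
    have h := inner_le_zero_of_mem_normalCone (convex_closedBall _ _) hζ.1 hmem
    rw [show z + (y - w) - x = (z - x) - (w - y) by abel, inner_sub_right] at h
    have h' := real_inner_le_norm ζ (w - y)
    have h'' : ‖ζ‖ * ‖w - y‖ ≤ D.M * ‖w - y‖ :=
      mul_le_mul_of_nonneg_right (mem_closedBall_zero_iff.1 hζ.2) (norm_nonneg _)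
    linarith
  have h2 : inner ℝ (k • (z - w)) (x - z) ≤
      D.M * ‖w - y‖ + Real.sqrt (8 * (D.M / D.R₁) / γ) := by
    rw [show x - z = ((x - y) - (z - w)) + (y - w) by abel, inner_add_right]
    have e1 : inner ℝ (k • (z - w)) (y - w) ≤ D.M * ‖w - y‖ := by
      rw [norm_sub_rev w y]
      exact (real_inner_le_norm _ _).trans (mul_le_mul_of_nonneg_right hkM (norm_nonneg _))
    -- Both relative positions have norm at most R₁, so only the slack of z is left.
    have e2 : inner ℝ (z - w) ((x - y) - (z - w)) ≤ D.R₁ ^ 2 - ‖z - w‖ ^ 2 := by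
      rw [inner_sub_right, real_inner_self_eq_norm_sq]
      have := (real_inner_le_norm (z - w) (x - y)).trans
        (mul_le_mul hz hx (norm_nonneg _) hR.le)
      linarith
    have e3 : inner ℝ (k • (z - w)) ((x - y) - (z - w)) ≤
        Real.sqrt (8 * (D.M / D.R₁) / γ) := by
      rw [real_inner_smul_left]
      have hpen := penalty_mul_le hD hγ hz
      have hs : 0 ≤ D.R₁ ^ 2 - ‖z - w‖ ^ 2 := by
        have := pow_le_pow_left₀ (norm_nonneg _) hz 2
        linarith
      calc _ ≤ k * (D.R₁ ^ 2 - ‖z - w‖ ^ 2) := mul_le_mul_of_nonneg_left e2 hk0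
        _ = a * (D.penalty γ z w * (D.R₁ ^ 2 - ‖z - w‖ ^ 2)) := by rw [hk, mul_assoc]
        _ ≤ D.penalty γ z w * (D.R₁ ^ 2 - ‖z - w‖ ^ 2) :=
          mul_le_of_le_one_left (mul_nonneg hp hs) ha.2
        _ ≤ _ := hpen
    linarith
  rw [← neg_sub z x, inner_neg_right] at h2
  rw [inner_sub_left]
  linarith

/-- A solution of the sweeping system with multiplier solves every penalized system. -/
theorem FeasibleL.feasibleApprox (hD : D.Standing) {γ : ℝ} (hγ : D.M / D.R₁ < γ) {T : ℝ}
    {y x : ℝ → E n} {u : ℝ → E m} {u₀ : ℝ → ℝ} (h : D.FeasibleL T y x u u₀) :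
    D.FeasibleApprox γ T y x u u₀ where
  ac_x := h.ac_x
  mem_u := h.mem_u
  mem_u₀ := h.mem_u₀
  initial := h.initial
  constraint t ht :=
    (hL_nonpos_iff hD.R₁_pos.le _ _).2 (mem_closedBall_iff_norm.1 (h.constraint t ht))
  dynamics := by
    filter_upwards [h.dynamics, h.active] with t hd ha
    convert hd using 1
    rw [sub_eq_add_neg, ← neg_smul]
    congr 2
    -- On the boundary `hL` = 0 and the minimum is M/R₁ because M/R₁ < γ; off the boundary `active`
    -- forces u₀ = 0.
    by_cases hb : x t ∈ frontier (D.movingSet (y t))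
    · have hb' : ‖x t - y t‖ = D.R₁ := by rwa [hD.frontier_movingSet] at hb
      rw [fbar, if_pos hb, penalty, hL, hb', sub_self, zero_div, mul_zero, Real.exp_zero, mul_one,
        min_eq_left hγ.le]
      ring
    · rw [not_imp_comm.1 ha hb]
      ring

/-- On the boundary the multiplier term is an outward radial vector of norm M u₀ ≤ M; in the
interior it is zero. -/
theorem FeasibleL.solvesInclusion (hD : D.Standing) {T : ℝ}
    {y x : ℝ → E n} {u : ℝ → E m} {u₀ : ℝ → ℝ} (h : D.FeasibleL T y x u u₀) :
    D.SolvesInclusion T y u x where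
  ac_x := h.ac_x
  mem_u := h.mem_u
  initial := h.initial
  constraint t ht :=
    (hL_nonpos_iff hD.R₁_pos.le _ _).2 (mem_closedBall_iff_norm.1 (h.constraint t ht))
  inclusion := by
    filter_upwards [h.dynamics, h.mem_u₀.2, ae_restrict_mem measurableSet_Icc] with t hd h0 ht
    refine ⟨-((D.fbar (x t) (y t) * u₀ t) • (x t - y t)), ?_, by rwa [sub_neg_eq_add]⟩
    by_cases hb : x t ∈ frontier (D.movingSet (y t))
    · have hb' : ‖x t - y t‖ = D.R₁ := by rwa [hD.frontier_movingSet] at hb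
      have hc : 0 ≤ D.M / D.R₁ * u₀ t := mul_nonneg hD.div_pos.le h0.1
      rw [fbar, if_pos hb, ← neg_smul, neg_mul, neg_neg]
      refine ⟨(isProximalNormal_smul_sub hc hb').mem_normalCone, ?_⟩
      rw [mem_closedBall_zero_iff, norm_smul, Real.norm_of_nonneg hc, hb', mul_right_comm,
        div_mul_cancel₀ _ hD.R₁_pos.ne']
      exact mul_le_of_le_one_right hD.M_pos.le h0.2
    · rw [fbar, if_neg hb, zero_mul, zero_smul, neg_zero]
      refine ⟨(isProximalNormal_zero (h.constraint t ht)).mem_normalCone, ?_⟩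
      rw [mem_closedBall_zero_iff, norm_zero]
      exact hD.M_pos.le

theorem SolvesInclusion.mem_movingSet (hD : D.Standing) {T : ℝ} {y x : ℝ → E n} {u : ℝ → E m}
    (h : D.SolvesInclusion T y u x) {t : ℝ} (ht : t ∈ Icc 0 T) : x t ∈ D.movingSet (y t) :=
  mem_closedBall_iff_norm.2 ((hL_nonpos_iff hD.R₁_pos.le _ _).1 (h.constraint t ht))

/-- By monotonicity the normal terms do not increase |z - x|², so only the Lipschitz drift
contributes and Grönwall applies with zero forcing. -/
theorem SolvesInclusion.eqOn (hD : D.Standing) {T : ℝ} {y x z : ℝ → E n} {u : ℝ → E m}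
    (hx : D.SolvesInclusion T y u x) (hz : D.SolvesInclusion T y u z) (h0 : z 0 = x 0) :
    EqOn z x (Icc 0 T) := by
  obtain ⟨K, hK⟩ := hD.lipschitz_f
  intro t ht
  have key := le_exp_mul_of_ae_deriv_le (C := 2 * K) (g := fun _ => 0) (by positivity)
    (absolutelyContinuousOnInterval_norm_sq (hz.ac_x.fun_sub hx.ac_x)) integrableOn_zero
    (fun _ => le_rfl) (by
      filter_upwards [hx.inclusion, hz.inclusion, hx.mem_u.2, ae_restrict_mem measurableSet_Icc]
        with s ⟨ζ, hζ, hdx⟩ ⟨ξ, hξ, hdz⟩ hu hs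
      refine ⟨_, (hdz.fun_sub hdx).norm_sq, ?_⟩
      have h1 := inner_sub_nonneg_of_mem_truncatedNormalCone (hx.mem_movingSet hD hs)
        (hz.mem_movingSet hD hs) hζ hξ
      have h2 : inner ℝ (z s - x s) (D.f (z s) (u s) - D.f (x s) (u s)) ≤
          K * ‖z s - x s‖ ^ 2 := by
        refine (real_inner_le_norm _ _).trans ?_
        have := (hK _ hu).norm_sub_le (z s) (x s)
        nlinarith [norm_nonneg (z s - x s)]
      rw [show D.f (z s) (u s) - ξ - (D.f (x s) (u s) - ζ) =
        (D.f (z s) (u s) - D.f (x s) (u s)) - (ξ - ζ) by abel, inner_sub_right,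
        real_inner_comm (ξ - ζ)]
      linarith) ht
  simp only [h0, sub_self, norm_zero, integral_zero] at key
  have h3 : ‖z t - x t‖ ^ 2 = 0 := le_antisymm (by simpa using key) (sq_nonneg _)
  exact sub_eq_zero.1 (norm_eq_zero.1 (pow_eq_zero_iff two_ne_zero |>.1 h3))

end Data

end Sweeping

/-! ### Measurability of the drift and the Grönwall comparison. -/

namespace Sweeping

variable {n m : ℕ}

namespace Data

variable {D : Data n m}

open Classical in
/-- The drift, set to zero for control values outside `U`. -/
noncomputable def drift (D : Data n m) (x : E n) (u : E m) : E n := if u ∈ D.U then D.f x u else 0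

theorem drift_of_mem {x : E n} {u : E m} (hu : u ∈ D.U) : D.drift x u = D.f x u := if_pos hu

/-- This is Carathéodory's criterion: continuity in the state and measurability in the control.
Cutting off outside the measurable set U preserves both. -/
theorem Standing.measurable_drift (hD : D.Standing) :
    Measurable (Function.uncurry D.drift) := by
  refine measurable_uncurry_of_continuous_of_measurable (u := D.drift) (fun u => ?_) fun x => ?_
  · obtain ⟨K, hK⟩ := hD.lipschitz_f
    by_cases hu : u ∈ D.U
    · simpa only [drift, if_pos hu] using (hK u hu).continuous
    · simpa only [drift, if_neg hu] using continuous_const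
  · exact Measurable.ite hD.compact_U.measurableSet (hD.measurable_f x) measurable_const

theorem norm_drift_le {M₁ : ℝ} (hM : 0 ≤ M₁) (h : ∀ x, ∀ u ∈ D.U, ‖D.f x u‖ ≤ M₁) (x : E n)
    (u : E m) : ‖D.drift x u‖ ≤ M₁ := by
  rw [drift]
  split_ifs with hu
  · exact h x u hu
  · rwa [norm_zero]

theorem aestronglyMeasurable_drift (hD : D.Standing) {T : ℝ} {x : ℝ → E n} {u : ℝ → E m}
    (hx : ContinuousOn x (Icc 0 T)) (hu : AEStronglyMeasurable u (timeMeasure T)) :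
    AEStronglyMeasurable (fun t => D.drift (x t) (u t)) (timeMeasure T) :=
  (hD.measurable_drift.comp_aemeasurable
    ((hx.aemeasurable measurableSet_Icc).prodMk hu.aemeasurable)).aestronglyMeasurable

/-- Arcs whose speed is almost everywhere at most `L` are `L`-Lipschitz. -/
theorem norm_sub_le_of_ae_norm_deriv_le {T L : ℝ} {x : ℝ → E n}
    (hx : AbsolutelyContinuousOnInterval x 0 T)
    (h : ∀ᵐ t ∂(timeMeasure T), ∃ d, HasDerivAt x d t ∧ ‖d‖ ≤ L) {s t : ℝ} (hs : 0 ≤ s)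
    (hst : s ≤ t) (ht : t ≤ T) : ‖x t - x s‖ ≤ L * (t - s) := by
  have hsub : Icc s t ⊆ Icc 0 T := Icc_subset_Icc hs ht
  have := norm_sub_le_integral_of_ae_norm_deriv_le (g := fun _ => L) hst
    (hx.mono (by rwa [uIcc_of_le hst, uIcc_of_le (hs.trans (hst.trans ht))]))
    (integrableOn_const (by simp)) (ae_restrict_of_ae_restrict_of_subset hsub h)
  rwa [intervalIntegral.integral_const, smul_eq_mul, mul_comm] at this

theorem FeasibleApprox.ae_norm_deriv_le (hD : D.Standing) {γ : ℝ} (hγ : 0 < γ) {M₁ T : ℝ}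
    (hM : ∀ x, ∀ u ∈ D.U, ‖D.f x u‖ ≤ M₁) {y x : ℝ → E n} {u : ℝ → E m} {u₀ : ℝ → ℝ}
    (h : D.FeasibleApprox γ T y x u u₀) :
    ∀ᵐ t ∂(timeMeasure T), ∃ d, HasDerivAt x d t ∧ ‖d‖ ≤ M₁ + D.M := by
  filter_upwards [h.dynamics, h.mem_u.2, h.mem_u₀.2, ae_restrict_mem measurableSet_Icc]
    with t hd hu h0 ht
  exact ⟨_, hd, (norm_sub_le _ _).trans (add_le_add (hM _ _ hu) (norm_penalty_smul_le hD hγ h0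
    ((hL_nonpos_iff hD.R₁_pos.le _ _).1 (h.constraint t ht))))⟩

theorem SolvesInclusion.ae_norm_deriv_le {M₁ T : ℝ}
    (hM : ∀ x, ∀ u ∈ D.U, ‖D.f x u‖ ≤ M₁) {y x : ℝ → E n} {u : ℝ → E m}
    (h : D.SolvesInclusion T y u x) :
    ∀ᵐ t ∂(timeMeasure T), ∃ d, HasDerivAt x d t ∧ ‖d‖ ≤ M₁ + D.M := by
  filter_upwards [h.inclusion, h.mem_u.2] with t ⟨ζ, hζ, hd⟩ hu
  exact ⟨_, hd, (norm_sub_le _ _).trans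
    (add_le_add (hM _ _ hu) (mem_closedBall_zero_iff.1 hζ.2))⟩

/-- Grönwall comparison of a penalized arc with a solution of the inclusion, on a common
interval on which the centres of the moving balls are `δ`-close. -/
theorem norm_sq_sub_le (hD : D.Standing) {γ : ℝ} (hγ : 0 < γ) {K : ℝ≥0}
    (hK : ∀ u ∈ D.U, LipschitzWith K fun x => D.f x u) {T T' S δ : ℝ} (hST : S ≤ T)
    (hST' : S ≤ T') {y x w z : ℝ → E n} {u u' : ℝ → E m} {u₀ : ℝ → ℝ}
    (hx : D.SolvesInclusion T y u x) (hz : D.FeasibleApprox γ T' w z u' u₀)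
    (hδ : ∀ t ∈ Icc 0 S, ‖w t - y t‖ ≤ δ) {t : ℝ} (ht : t ∈ Icc 0 S) :
    ‖z t - x t‖ ^ 2 ≤ Real.exp (2 * K * S) * (‖z 0 - x 0‖ ^ 2 +
      (2 * (2 * D.R₁ + δ) * (∫ s in Icc 0 S, ‖D.drift (x s) (u' s) - D.drift (x s) (u s)‖) +
        2 * (2 * D.M * δ + Real.sqrt (8 * (D.M / D.R₁) / γ)) * S)) := by
  have hsT : Icc 0 S ⊆ Icc 0 T := Icc_subset_Icc_right hST
  have hsT' : Icc 0 S ⊆ Icc 0 T' := Icc_subset_Icc_right hST'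
  have hS0 : 0 ≤ S := ht.1.trans ht.2
  have hδ0 : 0 ≤ δ := (norm_nonneg _).trans (hδ t ht)
  have hR := hD.R₁_pos
  have hM := hD.M_pos
  set ε := Real.sqrt (8 * (D.M / D.R₁) / γ) with hε
  have hε0 : 0 ≤ ε := Real.sqrt_nonneg _
  obtain ⟨M₁, hM₁, hbd⟩ := hD.bounded_f
  set G : ℝ → ℝ := fun s => ‖D.drift (x s) (u' s) - D.drift (x s) (u s)‖ with hG
  have hxc : ContinuousOn x (Icc 0 S) := by
    have := hx.ac_x.continuousOn
    rw [uIcc_of_le (hS0.trans hST)] at this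
    exact this.mono hsT
  have hGm : AEStronglyMeasurable G (timeMeasure S) :=
    ((aestronglyMeasurable_drift hD hxc
      (hz.mem_u.1.1.mono_measure (Measure.restrict_mono hsT' le_rfl))).sub
    (aestronglyMeasurable_drift hD hxc
      (hx.mem_u.1.1.mono_measure (Measure.restrict_mono hsT le_rfl)))).norm
  have hGi : IntegrableOn G (Icc 0 S) := by
    refine Integrable.mono' (g := fun _ => M₁ + M₁) (integrableOn_const (by simp)) hGm
      (ae_of_all _ fun s => ?_)
    rw [hG, norm_norm]
    exact (norm_sub_le _ _).trans
      (add_le_add (norm_drift_le hM₁.le hbd _ _) (norm_drift_le hM₁.le hbd _ _))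
  have hci : IntegrableOn (fun _ : ℝ => 2 * (2 * D.M * δ + ε)) (Icc 0 S) :=
    integrableOn_const (by simp)
  have hac : AbsolutelyContinuousOnInterval (fun s => z s - x s) 0 S := by
    refine (hz.ac_x.mono ?_).fun_sub (hx.ac_x.mono ?_)
    · rwa [uIcc_of_le hS0, uIcc_of_le (hS0.trans hST')]
    · rwa [uIcc_of_le hS0, uIcc_of_le (hS0.trans hST)]
  have key := le_exp_mul_of_ae_deriv_le (C := 2 * K)
    (g := fun s => 2 * (2 * D.R₁ + δ) * G s + 2 * (2 * D.M * δ + ε)) (by positivity)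
    (absolutelyContinuousOnInterval_norm_sq hac) ((hGi.const_mul _).add hci)
    (fun s => by positivity) (by
      filter_upwards [ae_restrict_of_ae_restrict_of_subset hsT hx.inclusion,
        ae_restrict_of_ae_restrict_of_subset hsT' hz.dynamics,
        ae_restrict_of_ae_restrict_of_subset hsT hx.mem_u.2,
        ae_restrict_of_ae_restrict_of_subset hsT' hz.mem_u.2,
        ae_restrict_of_ae_restrict_of_subset hsT' hz.mem_u₀.2,
        ae_restrict_mem measurableSet_Icc] with s ⟨ζ, hζ, hdx⟩ hdz hu hu' h0 hs
      refine ⟨_, (hdz.fun_sub hdx).norm_sq, ?_⟩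
      have bx : ‖x s - y s‖ ≤ D.R₁ := mem_closedBall_iff_norm.1 (hx.mem_movingSet hD (hsT hs))
      have bz : ‖z s - w s‖ ≤ D.R₁ := (hL_nonpos_iff hR.le _ _).1 (hz.constraint s (hsT' hs))
      have bw := hδ s hs
      have bzx : ‖z s - x s‖ ≤ 2 * D.R₁ + δ := by
        rw [show z s - x s = (z s - w s) + (w s - y s) - (x s - y s) by abel]
        have := norm_sub_le ((z s - w s) + (w s - y s)) (x s - y s)
        have := norm_add_le (z s - w s) (w s - y s)
        linarith
      have h1 := inner_sub_penalty_le hD hγ h0 bx bz hζ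
      have h1' : 2 * D.M * ‖w s - y s‖ ≤ 2 * D.M * δ := by gcongr
      have h2 : inner ℝ (D.f (z s) (u' s) - D.f (x s) (u' s)) (z s - x s) ≤
          K * ‖z s - x s‖ ^ 2 := by
        refine (real_inner_le_norm _ _).trans ?_
        rw [sq, ← mul_assoc]
        exact mul_le_mul_of_nonneg_right ((hK _ hu').norm_sub_le (z s) (x s)) (norm_nonneg _)
      have h3 : inner ℝ (D.f (x s) (u' s) - D.f (x s) (u s)) (z s - x s) ≤
          (2 * D.R₁ + δ) * G s := by
        refine (real_inner_le_norm _ _).trans ?_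
        rw [hG]
        simp only [drift_of_mem hu, drift_of_mem hu']
        rw [mul_comm]
        exact mul_le_mul_of_nonneg_right bzx (norm_nonneg _)
      -- The drift difference is split at f(x, u'): the state changes under the fixed control u',
      -- then the control changes along the fixed arc x. The control error thus never involves z.
      rw [real_inner_comm, show D.f (z s) (u' s) -
          (u₀ s * D.penalty γ (z s) (w s)) • (z s - w s) - (D.f (x s) (u s) - ζ) =
          (D.f (z s) (u' s) - D.f (x s) (u' s)) + (D.f (x s) (u' s) - D.f (x s) (u s)) +
          (ζ - (u₀ s * D.penalty γ (z s) (w s)) • (z s - w s)) by abel,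
        inner_add_left, inner_add_left]
      linarith) ht
  rw [integral_add (hGi.const_mul _) hci, integral_const_mul, setIntegral_const,
    Measure.real, Real.volume_Icc, ENNReal.toReal_ofReal (by linarith), sub_zero, smul_eq_mul,
    mul_comm S] at key
  refine key.trans (mul_le_mul_of_nonneg_right (Real.exp_le_exp.2 ?_) ?_)
  · have := ht.2
    gcongr
  · have : 0 ≤ ∫ s in Icc 0 S, G s := integral_nonneg fun s => norm_nonneg _
    positivity

end Data

/-! ### L¹ distances across different intervals and convergence of the drifts. -/

/-- The `L¹` distance between two functions on `[0, T]` and `[0, T']`, extended by zero. -/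
noncomputable def extendedDist {F : Type*} [NormedAddCommGroup F] (T T' : ℝ) (v w : ℝ → F) : ℝ :=
  (eLpNorm ((Icc 0 T).indicator v - (Icc 0 T').indicator w) 1 volume).toReal

theorem integrable_indicator_Icc {F : Type*} [NormedAddCommGroup F] {T : ℝ} {p : ℝ≥0∞}
    (hp : 1 ≤ p) {v : ℝ → F} (hv : MemLp v p (timeMeasure T)) :
    Integrable ((Icc 0 T).indicator v) := by
  have : IsFiniteMeasure (timeMeasure T) := by
    unfold timeMeasure
    infer_instance
  exact (integrable_indicator_iff measurableSet_Icc).2 (hv.integrable hp)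

theorem setIntegral_norm_sub_le_extendedDist {F : Type*} [NormedAddCommGroup F] {T T' S : ℝ}
    {v w : ℝ → F} (hv : Integrable ((Icc 0 T).indicator v))
    (hw : Integrable ((Icc 0 T').indicator w)) (hT : S ≤ T) (hT' : S ≤ T') :
    IntegrableOn (fun t => ‖v t - w t‖) (Icc 0 S) ∧
      ∫ t in Icc 0 S, ‖v t - w t‖ ≤ extendedDist T T' v w := by
  have heq : EqOn (fun t => ‖(Icc 0 T).indicator v t - (Icc 0 T').indicator w t‖)
      (fun t => ‖v t - w t‖) (Icc 0 S) := fun t ht => by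
    simp only [indicator_of_mem (Icc_subset_Icc_right hT ht),
      indicator_of_mem (Icc_subset_Icc_right hT' ht)]
  have hi := (hv.sub hw).norm
  refine ⟨hi.integrableOn.congr_fun heq measurableSet_Icc, ?_⟩
  rw [← setIntegral_congr_fun measurableSet_Icc heq, extendedDist, eLpNorm_one_eq_lintegral_enorm,
    ← integral_norm_eq_lintegral_enorm (hv.sub hw).1]
  exact setIntegral_le_integral hi (ae_of_all _ fun _ => norm_nonneg _)

end Sweeping

namespace Sweeping

variable {n m : ℕ}

namespace Data

variable {D : Data n m}

/-- Both centres start at y₀, so their distance is at most the integral of |v_q - v_p|. -/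
theorem UpperDynamics.norm_sub_le {p q : CtrlProcess n m} (hpS : D.InSpace p)
    (hqS : D.InSpace q) (hp : D.UpperDynamics p) (hq : D.UpperDynamics q) {t : ℝ}
    (ht : t ∈ Icc 0 (min p.T q.T)) :
    ‖q.y t - p.y t‖ ≤ extendedDist q.T p.T q.v p.v := by
  have htp : t ≤ p.T := ht.2.trans (min_le_left _ _)
  have htq : t ≤ q.T := ht.2.trans (min_le_right _ _)
  obtain ⟨hi, hle⟩ := setIntegral_norm_sub_le_extendedDist
    (integrable_indicator_Icc one_le_two hqS.mem_v.1)
    (integrable_indicator_Icc one_le_two hpS.mem_v.1) htq htp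
  have key := norm_sub_le_integral_of_ae_norm_deriv_le (φ := fun s => q.y s - p.y s) ht.1
    ((hqS.ac_y.mono (by
      rw [uIcc_of_le ht.1, uIcc_of_le hqS.T_pos.le]; exact Icc_subset_Icc_right htq)).fun_sub
      (hpS.ac_y.mono (by
        rw [uIcc_of_le ht.1, uIcc_of_le hpS.T_pos.le]; exact Icc_subset_Icc_right htp))) hi (by
    filter_upwards [ae_restrict_of_ae_restrict_of_subset (Icc_subset_Icc_right htq) hq.2,
      ae_restrict_of_ae_restrict_of_subset (Icc_subset_Icc_right htp) hp.2] with s h1 h2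
    exact ⟨_, h1.fun_sub h2, le_rfl⟩)
  rw [hp.1, hq.1, sub_self, sub_zero, intervalIntegral.integral_of_le ht.1,
    ← integral_Icc_eq_integral_Ioc] at key
  exact key.trans hle

/-- `L¹` convergence of the controls gives, along a subsequence, `L¹` convergence of the drifts
along a fixed arc. -/
theorem exists_subseq_tendsto_integral_drift (hD : D.Standing)
    (hf : ∀ z, ContinuousOn (D.f z) D.U) {T : ℝ} {x : ℝ → E n}
    (hx : ContinuousOn x (Icc 0 T)) {u : ℝ → E m} (hu : u ∈ D.controlsU T) {Ts : ℕ → ℝ}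
    {us : ℕ → ℝ → E m} (hus : ∀ k, us k ∈ D.controlsU (Ts k)) (hT : Tendsto Ts atTop (𝓝 T))
    (hlim : Tendsto (fun k => eLpNorm ((Icc 0 (Ts k)).indicator (us k) - (Icc 0 T).indicator u) 1
      volume) atTop (𝓝 0)) :
    ∃ φ : ℕ → ℕ, StrictMono φ ∧ Tendsto (fun j => ∫ s in Icc 0 (min T (Ts (φ j))),
      ‖D.drift (x s) (us (φ j) s) - D.drift (x s) (u s)‖) atTop (𝓝 0) := by
  -- L¹ convergence implies convergence in measure, hence a.e. convergence along a subsequence.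
  obtain ⟨φ, hφ, hae⟩ := (tendstoInMeasure_of_tendsto_eLpNorm one_ne_zero
    (fun k => (integrable_indicator_Icc le_top (hus k).1).1)
    (integrable_indicator_Icc le_top hu.1).1 hlim).exists_seq_tendsto_ae
  refine ⟨φ, hφ, ?_⟩
  obtain ⟨M₁, hM₁, hbd⟩ := hD.bounded_f
  set S : ℕ → ℝ := fun j => min T (Ts (φ j)) with hS
  set G : ℕ → ℝ → ℝ := fun j s => ‖D.drift (x s) (us (φ j) s) - D.drift (x s) (u s)‖ with hG
  have hsT (j : ℕ) : Icc 0 (S j) ⊆ Icc 0 T := Icc_subset_Icc_right (min_le_left _ _)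
  have hsT' (j : ℕ) : Icc 0 (S j) ⊆ Icc 0 (Ts (φ j)) := Icc_subset_Icc_right (min_le_right _ _)
  have hGm (j : ℕ) : AEStronglyMeasurable (G j) (timeMeasure (S j)) :=
    ((aestronglyMeasurable_drift hD (hx.mono (hsT j))
      ((hus (φ j)).1.1.mono_measure (Measure.restrict_mono (hsT' j) le_rfl))).sub
    (aestronglyMeasurable_drift hD (hx.mono (hsT j))
      (hu.1.1.mono_measure (Measure.restrict_mono (hsT j) le_rfl)))).norm
  have hGb (j : ℕ) (s : ℝ) : ‖G j s‖ ≤ M₁ + M₁ := by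
    rw [hG, norm_norm]
    exact (norm_sub_le _ _).trans
      (add_le_add (norm_drift_le hM₁.le hbd _ _) (norm_drift_le hM₁.le hbd _ _))
  -- Indicators move the varying intervals into the integrand, as dominated convergence requires.
  have heq (j : ℕ) : ∫ s in Icc 0 (S j), G j s =
      ∫ s in Icc 0 T, (Icc 0 (S j)).indicator (G j) s := by
    rw [setIntegral_indicator measurableSet_Icc, inter_eq_self_of_subset_right (hsT j)]
  have hus' : ∀ᵐ t, ∀ j, t ∈ Icc 0 (Ts (φ j)) → us (φ j) t ∈ D.U :=
    ae_all_iff.2 fun j => (ae_restrict_iff' measurableSet_Icc).1 (hus (φ j)).2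
  refine Tendsto.congr (fun j => (heq j).symm) ?_
  suffices hsuff : Tendsto (fun j => ∫ s in Icc 0 T, (Icc 0 (S j)).indicator (G j) s) atTop
      (𝓝 (∫ _ in Icc 0 T, (0 : ℝ))) by rwa [integral_zero] at hsuff
  refine tendsto_integral_of_dominated_convergence (fun _ => M₁ + M₁) (fun j => ?_)
    ?_ (fun j => ae_of_all _ fun s => ?_) ?_
  · have h := (aestronglyMeasurable_indicator_iff (μ := volume) measurableSet_Icc).2 (hGm j)
    exact h.mono_measure Measure.restrict_le_self
  · exact integrable_const _
  · exact (norm_indicator_le_norm_self _ _).trans (hGb j s)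
  -- Each t < T eventually lies in `[0, Ts (φ j)]`; the endpoint T need not, and is discarded as a
  -- null set.
  · have hne : ∀ᵐ t ∂(volume.restrict (Icc 0 T)), t ≠ T :=
      ae_restrict_of_ae (Measure.ae_ne volume T)
    filter_upwards [hu.2, ae_restrict_of_ae hus', ae_restrict_of_ae hae, hne,
      ae_restrict_mem measurableSet_Icc] with t hut hust hconv htne ht
    have htT : t < T := lt_of_le_of_ne ht.2 htne
    have hev : ∀ᶠ j in atTop, t ∈ Icc 0 (Ts (φ j)) := by
      filter_upwards [(hT.comp hφ.tendsto_atTop).eventually (lt_mem_nhds htT)] with j hj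
      exact ⟨ht.1, hj.le⟩
    rw [indicator_of_mem ht] at hconv
    have hconv' : Tendsto (fun j => us (φ j) t) atTop (𝓝[D.U] (u t)) := by
      refine tendsto_nhdsWithin_iff.2 ⟨hconv.congr' ?_, ?_⟩
      · filter_upwards [hev] with j hj
        rw [indicator_of_mem hj]
      · filter_upwards [hev] with j hj using hust j hj
    have hfc : Tendsto (fun j => ‖D.f (x t) (us (φ j) t) - D.f (x t) (u t)‖) atTop (𝓝 0) :=
      tendsto_iff_norm_sub_tendsto_zero.1 ((hf (x t) (u t) hut).tendsto.comp hconv')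
    refine hfc.congr' ?_
    filter_upwards [hev] with j hj
    rw [indicator_of_mem (show t ∈ Icc 0 (S j) from ⟨ht.1, le_min ht.2 hj.2⟩), hG]
    simp only [drift_of_mem hut, drift_of_mem (hust j hj)]

end Data

/-! ### Uniform convergence of the arcs of an approximating sequence. -/

/-- Arcs with a common Lipschitz constant that are uniformly close on the common interval are
uniformly close once extended by their final values. -/
theorem norm_extend_sub_extend_le {F : Type*} [NormedAddCommGroup F] {T T' L c : ℝ}
    (hT : 0 ≤ T) (hT' : 0 ≤ T') {x z : ℝ → F}
    (hx : ∀ s t, 0 ≤ s → s ≤ t → t ≤ T → ‖x t - x s‖ ≤ L * (t - s))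
    (hz : ∀ s t, 0 ≤ s → s ≤ t → t ≤ T' → ‖z t - z s‖ ≤ L * (t - s)) (hL : 0 ≤ L)
    (hc : ∀ t ∈ Icc 0 (min T T'), ‖z t - x t‖ ≤ c) {t : ℝ} (ht : 0 ≤ t) :
    ‖z (min t T') - x (min t T)‖ ≤ c + L * |T - T'| := by
  rcases le_total T T' with h | h
  · rw [min_eq_left h] at hc
    have h1 := hc (min t T) ⟨le_min ht hT, min_le_right _ _⟩
    have h2 := hz (min t T) (min t T') (le_min ht hT) (min_le_min_left _ h) (min_le_right _ _)
    have h3 : min t T' - min t T ≤ |T - T'| := by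
      rw [abs_of_nonpos (by linarith)]
      rcases le_total t T with h4 | h4
      · rw [min_eq_left h4, min_eq_left (h4.trans h)]; linarith
      · rw [min_eq_right h4]
        linarith [min_le_right t T']
    have h4 := norm_sub_le_norm_sub_add_norm_sub (z (min t T')) (z (min t T)) (x (min t T))
    have h5 := mul_le_mul_of_nonneg_left h3 hL
    linarith
  · rw [min_eq_right h] at hc
    have h1 := hc (min t T') ⟨le_min ht hT', min_le_right _ _⟩
    have h2 := hx (min t T') (min t T) (le_min ht hT') (min_le_min_left _ h) (min_le_right _ _)
    have h3 : min t T - min t T' ≤ |T - T'| := by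
      rw [abs_of_nonneg (by linarith)]
      rcases le_total t T' with h4 | h4
      · rw [min_eq_left h4, min_eq_left (h4.trans h)]; linarith
      · rw [min_eq_right h4]
        linarith [min_le_right t T]
    rw [norm_sub_rev] at h2
    have h4 := norm_sub_le_norm_sub_add_norm_sub (z (min t T')) (x (min t T')) (x (min t T))
    have h5 := mul_le_mul_of_nonneg_left h3 hL
    linarith

theorem controlDist_self (p : CtrlProcess n m) : controlDist p p = 0 := by
  simp [controlDist]

namespace Approximates

variable {D : Data n m} {γ : ℕ → ℝ} {p : CtrlProcess n m} {q : ℕ → CtrlProcess n m}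

theorem tendsto_controlDist (h : Approximates D γ p q) :
    Tendsto (fun k => controlDist (q k) p) atTop (𝓝 0) :=
  tendsto_of_tendsto_of_tendsto_of_le_of_le tendsto_const_nhds h.tendsto (fun _ => zero_le)
    fun _ => le_add_self

theorem tendsto_time_add_initial (h : Approximates D γ p q) :
    Tendsto (fun k => |p.T - (q k).T| + ‖(q k).x 0 - p.x 0‖) atTop (𝓝 0) := by
  have h1 := tendsto_of_tendsto_of_tendsto_of_le_of_le tendsto_const_nhds h.tendsto
    (fun _ => zero_le) fun k => (le_self_add : ENNReal.ofReal (|p.T - (q k).T| +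
      ‖(q k).x 0 - p.x 0‖) ≤ _)
  have h2 := (ENNReal.tendsto_toReal ENNReal.zero_ne_top).comp h1
  rw [ENNReal.toReal_zero] at h2
  exact h2.congr fun k => ENNReal.toReal_ofReal (by positivity)

theorem tendsto_time_dist (h : Approximates D γ p q) :
    Tendsto (fun k => |p.T - (q k).T|) atTop (𝓝 0) :=
  squeeze_zero (fun _ => abs_nonneg _) (fun _ => le_add_of_nonneg_right (norm_nonneg _))
    h.tendsto_time_add_initial

theorem tendsto_time (h : Approximates D γ p q) :
    Tendsto (fun k => (q k).T) atTop (𝓝 p.T) := by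
  refine tendsto_iff_dist_tendsto_zero.2 (h.tendsto_time_dist.congr fun k => ?_)
  rw [dist_comm, Real.dist_eq]

theorem tendsto_initial (h : Approximates D γ p q) :
    Tendsto (fun k => ‖(q k).x 0 - p.x 0‖) atTop (𝓝 0) :=
  squeeze_zero (fun _ => norm_nonneg _) (fun _ => le_add_of_nonneg_left (abs_nonneg _))
    h.tendsto_time_add_initial

theorem tendsto_extendedDist_v (h : Approximates D γ p q) :
    Tendsto (fun k => extendedDist (q k).T p.T (q k).v p.v) atTop (𝓝 0) := by
  have h1 := tendsto_of_tendsto_of_tendsto_of_le_of_le tendsto_const_nhds h.tendsto_controlDist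
    (fun _ => zero_le) fun k => (le_self_add.trans le_self_add :
      eLpNorm ((Icc 0 (q k).T).indicator (q k).v - (Icc 0 p.T).indicator p.v) 1 volume ≤ _)
  exact (ENNReal.tendsto_toReal ENNReal.zero_ne_top).comp h1

theorem tendsto_eLpNorm_u (h : Approximates D γ p q) :
    Tendsto (fun k => eLpNorm ((Icc 0 (q k).T).indicator (q k).u - (Icc 0 p.T).indicator p.u) 1
      volume) atTop (𝓝 0) :=
  tendsto_of_tendsto_of_tendsto_of_le_of_le tendsto_const_nhds h.tendsto_controlDist
    (fun _ => zero_le) fun _ => le_add_self.trans le_self_add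

/-- If the drift is continuous in the control, the arcs of an approximating sequence converge
uniformly along a subsequence. -/
theorem exists_subseq_arcsTendstoUniformly (hD : D.Standing) (hγ : Tendsto γ atTop atTop)
    (hγM : ∀ k, D.M / D.R₁ < γ k) (hp : D.InSpace p) (hy : D.UpperDynamics p)
    (hx : D.SolvesInclusion p.T p.y p.u p.x) (hf : ∀ z, ContinuousOn (D.f z) D.U)
    (h : Approximates D γ p q) :
    ∃ φ : ℕ → ℕ, StrictMono φ ∧
      ArcsTendstoUniformly (fun j => (q (φ j)).T) (fun j => (q (φ j)).x) p.T p.x := by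
  have hxc : ContinuousOn p.x (Icc 0 p.T) := by
    have := hx.ac_x.continuousOn
    rwa [uIcc_of_le hp.T_pos.le] at this
  obtain ⟨φ, hφ, hint⟩ := Data.exists_subseq_tendsto_integral_drift hD hf hxc hx.mem_u
    (fun k => (h.feasible k).mem_u) h.tendsto_time h.tendsto_eLpNorm_u
  refine ⟨φ, hφ, ?_⟩
  obtain ⟨K, hK⟩ := hD.lipschitz_f
  obtain ⟨M₁, hM₁, hbd⟩ := hD.bounded_f
  have hγ0 (k : ℕ) : 0 < γ k := hD.div_pos.trans (hγM k)
  have hφt := hφ.tendsto_atTop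
  set I : ℕ → ℝ := fun j => ∫ s in Icc 0 (min p.T (q (φ j)).T),
    ‖D.drift (p.x s) ((q (φ j)).u s) - D.drift (p.x s) (p.u s)‖ with hI
  set δ : ℕ → ℝ := fun j => extendedDist (q (φ j)).T p.T (q (φ j)).v p.v with hδ
  set ε : ℕ → ℝ := fun j => Real.sqrt (8 * (D.M / D.R₁) / γ (φ j)) with hε
  -- This is the right-hand side of `norm_sq_sub_le` on the common interval; each summand contains a
  -- factor tending to zero.
  set A : ℕ → ℝ := fun j => Real.exp (2 * K * min p.T (q (φ j)).T) *
    (‖(q (φ j)).x 0 - p.x 0‖ ^ 2 + (2 * (2 * D.R₁ + δ j) * I j +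
      2 * (2 * D.M * δ j + ε j) * min p.T (q (φ j)).T)) with hA
  have hδ0 : Tendsto δ atTop (𝓝 0) := h.tendsto_extendedDist_v.comp hφt
  have hε0 : Tendsto ε atTop (𝓝 0) := by
    rw [← Real.sqrt_zero]
    exact ((hγ.comp hφt).const_div_atTop _).sqrt
  have hS : Tendsto (fun j => min p.T (q (φ j)).T) atTop (𝓝 p.T) := by
    simpa using (tendsto_const_nhds (x := p.T)).min (h.tendsto_time.comp hφt)
  have hA0 : Tendsto A atTop (𝓝 0) := by
    have := ((Real.continuous_exp.tendsto _).comp (hS.const_mul (2 * (K : ℝ)))).mul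
      (((h.tendsto_initial.comp hφt).pow 2).add
        ((((hδ0.const_add (2 * D.R₁)).const_mul 2).mul hint).add
          ((((hδ0.const_mul (2 * D.M)).add hε0).const_mul 2).mul hS)))
    simpa using this
  have hB0 : Tendsto (fun j => Real.sqrt (A j) + (M₁ + D.M) * |p.T - (q (φ j)).T|) atTop
      (𝓝 0) := by
    simpa using hA0.sqrt.add ((h.tendsto_time_dist.comp hφt).const_mul (M₁ + D.M))
  rw [ArcsTendstoUniformly, Metric.tendstoUniformlyOn_iff]
  intro r hr
  filter_upwards [hB0.eventually (gt_mem_nhds hr)] with j hj t ht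
  rw [dist_comm, dist_eq_norm]
  -- Both arcs have speed at most M₁ + M, which controls the part beyond the common interval by (M₁
  -- + M) |T - T_k|.
  refine (norm_extend_sub_extend_le hp.T_pos.le (h.mem (φ j)).T_pos.le
    (fun s t => Data.norm_sub_le_of_ae_norm_deriv_le hx.ac_x (hx.ae_norm_deriv_le hbd))
    (fun s t => Data.norm_sub_le_of_ae_norm_deriv_le (h.feasible (φ j)).ac_x
      ((h.feasible (φ j)).ae_norm_deriv_le hD (hγ0 _) hbd))
    (add_nonneg hM₁.le hD.M_pos.le) (fun s hs => ?_) ht).trans_lt hj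
  exact Real.le_sqrt_of_sq_le (Data.norm_sq_sub_le hD (hγ0 _) hK (min_le_left _ _)
    (min_le_right _ _) hx (h.feasible (φ j))
    (fun s hs => hy.norm_sub_le hp (h.mem (φ j)) (h.upper (φ j)) hs) hs)

end Approximates

end Sweeping

/-! ### The main theorem. -/

theorem mainTheorem3 {n m : ℕ} (D : Sweeping.Data n m) (hD : D.Standing)
    (γ : ℕ → ℝ) (hγ : Tendsto γ atTop atTop) (hγM : ∀ k, D.M / D.R₁ < γ k)
    (p : Sweeping.CtrlProcess n m) (hp : D.InSpace p) (hy : D.UpperDynamics p)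
    (hF : D.FeasibleL p.T p.y p.x p.u p.u₀) :
    -- there is an approximating sequence whose arcs, along a subsequence, converge to `x`
    (∃ q : ℕ → Sweeping.CtrlProcess n m, Sweeping.Approximates D γ p q ∧
      ∃ φ : ℕ → ℕ, StrictMono φ ∧
        Sweeping.ArcsTendstoUniformly (fun j => (q (φ j)).T) (fun j => (q (φ j)).x) p.T p.x) ∧
    -- if the drift is continuous in the control, so do the arcs of every such sequence
    ((∀ z, ContinuousOn (D.f z) D.U) →
      ∀ q : ℕ → Sweeping.CtrlProcess n m, Sweeping.Approximates D γ p q →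
        ∃ φ : ℕ → ℕ, StrictMono φ ∧
          Sweeping.ArcsTendstoUniformly (fun j => (q (φ j)).T) (fun j => (q (φ j)).x) p.T p.x) ∧
    -- the limit `x` is the unique solution of the sweeping inclusion
    D.IsUniqueSolution p.T p.y p.u p.x := by
  have hx := hF.solvesInclusion hD
  -- The approximating sequence is constantly `p`, so every distance is zero and the arcs already
  -- coincide with x.
  refine ⟨⟨fun _ => p, ⟨fun _ => hp, ?_, fun _ => hy, fun k => hF.feasibleApprox hD (hγM k)⟩,
    id, strictMono_id, ?_⟩, fun hf q hq => ?_, hx, fun z hz h0 => hx.eqOn hD hz h0⟩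
  · simp [Sweeping.controlDist_self]
  · exact tendstoUniformlyOn_iff_tendstoUniformlyOnFilter.2 fun u hu =>
      Eventually.of_forall fun _ => refl_mem_uniformity hu
  · exact hq.exists_subseq_arcsTendstoUniformly hD hγ hγM hp hy hx hf
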